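/- Let $d \geq 4$ be an even integer and let $k$ be a totally real number field. Then there exist $a_0, a_1, a_2, a_3 \in k^*$ such that the diagonal surface of degree $d$ $$a_0x_0^d + a_1x_1^d + a_2x_2^d + a_3x_3^d = 0$$ in $\mathbb{P}^3_k$ fails the Hasse principle for lines, i.e. it contains a line defined over the completion $k_v$ for every place $v$ of $k$ (archimedean or non-archimedean), but contains no line defined over $k$. -/

import Mathlib

open IsDedekindDomain NumberField

/-- The diagonal form `a₀ x₀ ^ d + a₁ x₁ ^ d + a₂ x₂ ^ d + a₃ x₃ ^ d` with nonzero coefficients.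
Its zero locus in `ℙ³` is the diagonal surface of degree `d` over `k` with coefficients `a`. -/
noncomputable def diagonalForm {k : Type*} [Field k] (d : ℕ) (a : Fin 4 → kˣ) :
    MvPolynomial (Fin 4) k :=
  ∑ i, MvPolynomial.C (a i : k) * MvPolynomial.X i ^ d

/-- Let `F` be a form in four variables over `k` and let `K` be an extension field of `k`.
The surface `F = 0` in `ℙ³` contains a line over `K` if there is a line `ℙ(W)` in `ℙ³` over `K`,
i.e. a two-dimensional subspace `W` of `K ^ 4`, which lies on the surface: for all `u v` in `W`
the form `F (S • u + T • v)` in the variables `S, T` is the zero polynomial over `K`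
(for infinite `K`, this says that `F` vanishes at every point of `W`). -/
def ContainsLineOver {k : Type*} [Field k] (F : MvPolynomial (Fin 4) k)
    (K : Type*) [Field K] [Algebra k K] : Prop :=
  ∃ W : Submodule K (Fin 4 → K), Module.finrank K W = 2 ∧ ∀ u ∈ W, ∀ v ∈ W,
    MvPolynomial.aeval
      (fun i => (MvPolynomial.C (u i) * MvPolynomial.X 0 +
        MvPolynomial.C (v i) * MvPolynomial.X 1 : MvPolynomial (Fin 2) K)) F = 0

/-- The surface `F = 0` over the number field `k` fails the Hasse principle for lines: it contains
a line over every completion of `k` (archimedean or not), but it contains no line over `k`. -/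
def FailsHassePrincipleForLines {k : Type*} [Field k] [NumberField k]
    (F : MvPolynomial (Fin 4) k) : Prop :=
  (∀ v : InfinitePlace k, ContainsLineOver F v.Completion) ∧
    (∀ v : HeightOneSpectrum (𝓞 k), ContainsLineOver F (v.adicCompletion k)) ∧
    ¬ ContainsLineOver F k

/-!
Over a field of characteristic zero, every line on a diagonal surface of degree `d ≥ 3` is an
obvious one: the four coordinates form two pairs, proportional in each, because at most `d + 1`
pairwise non-proportional binary linear forms have linearly independent `d`-th powers
(`exists_pairs_of_containsLineOver`). For the coefficients `1, -A, -B, AB` it follows that there is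
a line over `K` if `A` or `B` is a `d`-th power in `K`, and that a line over `k` makes `A`, `B` or
`-AB` a `d`-th power in `k`. So we look for `A` and `B` such that in every completion one of them is
a `d`-th power, while `A`, `B` and `-AB` are no `d`-th powers in `k`.

Let `N = n = ℓ` for an odd prime `ℓ ∣ d` if `4 ∤ d`, and `N = 4`, `n = 2` if `4 ∣ d`. The element
`B` is to be a `d`-th power in all extensions of `k` with primitive `N`-th roots of unity, but not
in `k`. This is where `k` has to be totally real.
* If `4 ∤ d`, then `k(ζ_ℓ)` is a cyclic extension of `k` of even order, because of complex
  conjugation. So it contains some `√D ∉ k`, and `B = D ^ (d / 2)`, with `d / 2` odd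
  (`exists_not_isPow_of_isPrimitiveRoot`).
* If `4 ∣ d`, let `y = 2cos(π / 2 ^ r)` with `y ∈ k` and `r` as large as possible subject to
  `2 ^ r ∣ d / 2`. Then `B = ±(2 + y) ^ (d / 2)`, with the negative sign if and only if `2 ^ (r + 1)`
  does not divide `d / 2`. Here `2 + y = (1 + ζ) ^ 2 / ζ` for a root of unity `ζ ∈ k(i)` with
  `ζ ^ 2 ^ r = -1` (`exists_not_isPow_of_four_dvd`; for `k = ℚ` and `d = 4` this is `B = -4`).

Now let `A = s ^ (d / n)`, where `s = Φ_N(y)` with `y` divisible by `N ^ 3`. At the places without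
primitive `N`-th roots of unity it is `A` that is a `d`-th power: at a prime not dividing `N`, the
element `s` is a unit, as prime divisors of cyclotomic values have primitive `N`-th roots of unity
in their residue fields, and an `n`-th power up to sign; at the primes dividing `N`, it is an `n`-th
power as `s ≡ 1` modulo `N ^ 3`. Both use Hensel's lemma for the completions
(`exists_aeval_eq_zero_adicCompletion`). At the real places `A > 0`, as `d / n` is even. Finally `y`
is chosen such that `s` has valuation `1` at a prime where `B` is a unit, whence neither `A` nor
`-AB` is a `d`-th power in `k`.
-/

/-! ### Lines on diagonal surfaces -/

section Lines

open MvPolynomial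

/-- Comparison of coefficients in a relation between `d`-th powers of binary linear forms. -/
theorem sum_mul_pow_mul_pow_eq_zero {K ι : Type*} [Field K] [CharZero K] [Fintype ι] {d : ℕ}
    {c u v : ι → K}
    (h : ∑ i, C (c i) * (C (u i) * X 0 + C (v i) * X 1 : MvPolynomial (Fin 2) K) ^ d = 0)
    {j : ℕ} (hj : j ≤ d) : ∑ i, c i * (u i ^ j * v i ^ (d - j)) = 0 := by
  have h1 := congrArg (aeval ![(Polynomial.X : Polynomial K), 1]) h
  simp only [map_sum, map_mul, map_pow, map_add, aeval_X, map_zero, algHom_C,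
    Polynomial.algebraMap_eq, Matrix.cons_val_zero, Matrix.cons_val_one, mul_one] at h1
  have h2 (a b : K) : ((Polynomial.C a * Polynomial.X + Polynomial.C b) ^ d).coeff j =
      a ^ j * b ^ (d - j) * d.choose j := by
    have h3 (m : ℕ) : (Polynomial.C a * Polynomial.X) ^ m * Polynomial.C b ^ (d - m) *
        (d.choose m : Polynomial K) =
        Polynomial.C (a ^ m * b ^ (d - m) * d.choose m) * Polynomial.X ^ m := by
      simp only [map_mul, map_pow, map_natCast]
      ring
    rw [add_pow, Finset.sum_congr rfl fun m _ => h3 m, Polynomial.finsetSum_coeff]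
    simp only [Polynomial.coeff_C_mul_X_pow]
    rw [Finset.sum_ite_eq, if_pos (Finset.mem_range.2 (by omega))]
  have h4 := congrArg (fun p => Polynomial.coeff p j) h1
  simp only [Polynomial.finsetSum_coeff, Polynomial.coeff_C_mul, h2, Polynomial.coeff_zero,
    ← mul_assoc] at h4
  rw [← Finset.sum_mul] at h4
  have h5 : (d.choose j : K) ≠ 0 := by exact_mod_cast (Nat.choose_pos hj).ne'
  simpa only [mul_assoc] using (mul_eq_zero.1 h4).resolve_right h5

/-- Apolarity: a relation between the `d`-th powers of the linear forms `u i * S + v i * T` is a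
relation between the values at the points `(u i, v i)` of every binary form of degree `d`. -/
theorem sum_mul_eval_eq_zero {K ι : Type*} [Field K] [CharZero K] [Fintype ι] {d : ℕ}
    {c u v : ι → K}
    (h : ∑ i, C (c i) * (C (u i) * X 0 + C (v i) * X 1 : MvPolynomial (Fin 2) K) ^ d = 0)
    {G : MvPolynomial (Fin 2) K} (hG : G.IsHomogeneous d) :
    ∑ i, c i * eval ![u i, v i] G = 0 := by
  simp only [eval_eq', Finset.mul_sum, Fin.prod_univ_two, Matrix.cons_val_zero,
    Matrix.cons_val_one]
  rw [Finset.sum_comm]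
  refine Finset.sum_eq_zero fun m hm => ?_
  have hd : m 0 + m 1 = d := by
    have := hG (mem_support_iff.1 hm)
    simpa [Finsupp.weight_apply, Finsupp.sum_fintype] using this
  have := sum_mul_pow_mul_pow_eq_zero h (j := m 0) (by omega)
  rw [show d - m 0 = m 1 by omega] at this
  calc _ = coeff m G * ∑ i, c i * (u i ^ m 0 * v i ^ m 1) := by
        rw [Finset.mul_sum]
        exact Finset.sum_congr rfl fun i _ => by ring
    _ = 0 := by rw [this, mul_zero]

theorem isHomogeneous_C_mul_X_add_C_mul_X {K : Type*} [Field K] (a b : K) :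
    (C a * X 0 + C b * X 1 : MvPolynomial (Fin 2) K).IsHomogeneous 1 :=
  (isHomogeneous_C_mul_X a 0).add (isHomogeneous_C_mul_X b 1)

/-- At most `d + 1` pairwise non-proportional binary linear forms have independent `d`-th powers;
so in a relation between four of these powers every nonzero form is proportional to another one. -/
theorem exists_ne_proportional {K : Type*} [Field K] [CharZero K] {d : ℕ} (hd : 3 ≤ d)
    {c u v : Fin 4 → K}
    (h : ∑ i, C (c i) * (C (u i) * X 0 + C (v i) * X 1 : MvPolynomial (Fin 2) K) ^ d = 0)
    (i : Fin 4) (hc : c i ≠ 0) (hi : u i ≠ 0 ∨ v i ≠ 0) :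
    ∃ j ≠ i, (u j ≠ 0 ∨ v j ≠ 0) ∧ u i * v j = u j * v i := by
  classical
  by_contra! hcon
  -- a linear form that does not vanish at `(u i, v i)`
  obtain ⟨a, b, hab⟩ : ∃ a b : K, a * u i + b * v i ≠ 0 := by
    rcases hi with hi | hi
    · exact ⟨1, 0, by simpa using hi⟩
    · exact ⟨0, 1, by simpa using hi⟩
  let φ : MvPolynomial (Fin 2) K := C a * X 0 + C b * X 1
  let D : Fin 4 → MvPolynomial (Fin 2) K := fun j => C (-v j) * X 0 + C (u j) * X 1
  let L : Fin 4 → MvPolynomial (Fin 2) K := fun j => if u j = 0 ∧ v j = 0 then φ else D j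
  have hL (j : Fin 4) : (L j).IsHomogeneous 1 := by
    dsimp only [L]
    split_ifs
    · exact isHomogeneous_C_mul_X_add_C_mul_X _ _
    · exact isHomogeneous_C_mul_X_add_C_mul_X _ _
  have hG : ((∏ j ∈ Finset.univ.erase i, L j) * φ ^ (d - 3)).IsHomogeneous d := by
    have h1 := IsHomogeneous.prod (Finset.univ.erase i) L (fun _ => 1) fun j _ => hL j
    have h2 := (isHomogeneous_C_mul_X_add_C_mul_X a b).pow (d - 3)
    have h3 := h1.mul h2
    rwa [Finset.sum_const, Finset.card_erase_of_mem (Finset.mem_univ _), Finset.card_univ,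
      Fintype.card_fin, smul_eq_mul, show (4 - 1) * 1 + 1 * (d - 3) = d by omega] at h3
  have h4 := sum_mul_eval_eq_zero h hG
  have hφ : eval ![u i, v i] φ ≠ 0 := by simpa [φ] using hab
  rw [Finset.sum_eq_single i] at h4
  · refine (mul_ne_zero hc ?_) h4
    rw [map_mul, map_prod, map_pow]
    refine mul_ne_zero (Finset.prod_ne_zero_iff.2 fun j hj => ?_) (pow_ne_zero _ hφ)
    dsimp only [L]
    split_ifs with h0
    · exact hφ
    · have := hcon j (Finset.ne_of_mem_erase hj) (by tauto)
      intro h5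
      apply this
      simp [D] at h5
      linear_combination -h5
  · intro j _ hji
    by_cases h0 : u j = 0 ∧ v j = 0
    · have h5 : eval (![u j, v j]) φ = 0 := by simp [φ, h0.1, h0.2]
      have h6 : eval (![u j, v j]) (L j) = 0 := by simp only [L, if_pos h0, h5]
      rw [map_mul, map_prod, Finset.prod_eq_zero (Finset.mem_erase.2 ⟨hji, Finset.mem_univ j⟩) h6]
      ring
    · have h6 : eval (![u j, v j]) (L j) = 0 := by
        simp only [L, if_neg h0, D]
        simp
        ring
      rw [map_mul, map_prod, Finset.prod_eq_zero (Finset.mem_erase.2 ⟨hji, Finset.mem_univ j⟩) h6]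
      ring
  · simp

/-- If the forms with indices `i`, `j` are proportional, and those with indices `m`, `n` too, but
not those with indices `i`, `m`, then the relation restricts to the indices `i`, `j`. -/
theorem exists_add_mul_pow_eq_zero {K : Type*} [Field K] [CharZero K] {d : ℕ} (hd : d ≠ 0)
    {c u v : Fin 4 → K}
    (h : ∑ i, C (c i) * (C (u i) * X 0 + C (v i) * X 1 : MvPolynomial (Fin 2) K) ^ d = 0)
    {i j m n : Fin 4} (hall : ∀ x, x = i ∨ x = j ∨ x = m ∨ x = n) (hji : j ≠ i)
    (hij : u i * v j = u j * v i) (hmn : u m * v n = u n * v m)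
    (him : u i * v m ≠ u m * v i) : ∃ t, c i + c j * t ^ d = 0 := by
  obtain ⟨t, ht1, ht2⟩ : ∃ t, u j = t * u i ∧ v j = t * v i := by
    by_cases hu : u i = 0
    · have hv : v i ≠ 0 := by
        intro hv
        simp [hu, hv] at him
      refine ⟨v j / v i, ?_, by field_simp⟩
      have : u j = 0 := by simpa [hu, hv] using hij.symm
      simp [hu, this]
    · refine ⟨u j / u i, by field_simp, ?_⟩
      field_simp
      linear_combination hij
  refine ⟨t, ?_⟩
  have h1 := sum_mul_eval_eq_zero h (G := (C (-v m) * X 0 + C (u m) * X 1) ^ d)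
    (by simpa using (isHomogeneous_C_mul_X_add_C_mul_X (-v m) (u m)).pow d)
  simp only [map_pow, map_add, map_mul, eval_C, eval_X, Matrix.cons_val_zero,
    Matrix.cons_val_one] at h1
  rw [Fintype.sum_eq_add i j hji.symm] at h1
  · rw [ht1, ht2] at h1
    have h2 : (-v m * u i + u m * v i) ^ d ≠ 0 := by
      refine pow_ne_zero _ fun h3 => him ?_
      linear_combination -h3
    refine (mul_eq_zero.1
      (?_ : (c i + c j * t ^ d) * (-v m * u i + u m * v i) ^ d = 0)).resolve_right h2
    rw [← h1, show -v m * (t * u i) + u m * (t * v i) = t * (-v m * u i + u m * v i) by ring,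
      mul_pow]
    ring
  · rintro x ⟨hxi, hxj⟩
    rcases hall x with rfl | rfl | rfl | rfl
    · exact absurd rfl hxi
    · exact absurd rfl hxj
    · rw [show -v x * u x + u x * v x = 0 by ring, zero_pow hd, mul_zero]
    · rw [show -v m * u x + u m * v x = 0 by linear_combination hmn, zero_pow hd, mul_zero]

theorem aeval_diagonalForm {k : Type*} [Field k] {A : Type*} [CommRing A] [Algebra k A] (d : ℕ)
    (a : Fin 4 → kˣ) (x : Fin 4 → A) :
    aeval x (diagonalForm d a) = ∑ i, algebraMap k A (a i) * x i ^ d := by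
  simp [diagonalForm]

theorem forall_eq_of_pairwise_ne : ∀ i j m n : Fin 4, i ≠ j → i ≠ m → i ≠ n → j ≠ m → j ≠ n →
    m ≠ n → ∀ x, x = i ∨ x = j ∨ x = m ∨ x = n := by
  decide

/-- Every line on a diagonal surface of degree `d ≥ 3` is one of the obvious ones: its equations
say that the coordinates are proportional in pairs. -/
theorem exists_pairs_of_containsLineOver {k : Type*} [Field k] [CharZero k] {d : ℕ} (hd : 3 ≤ d)
    (a : Fin 4 → kˣ) (h : ContainsLineOver (diagonalForm d a) k) :
    ∃ i j m n : Fin 4, (i ≠ j ∧ i ≠ m ∧ i ≠ n ∧ j ≠ m ∧ j ≠ n ∧ m ≠ n) ∧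
      (∃ t : k, (a i : k) + a j * t ^ d = 0) ∧ ∃ t : k, (a m : k) + a n * t ^ d = 0 := by
  obtain ⟨W, hW, hline⟩ := h
  have : Module.Finite k W := Module.finite_of_finrank_eq_succ hW
  let b := Module.finBasisOfFinrankEq k W hW
  have hli : LinearIndependent k ![(b 0 : Fin 4 → k), (b 1 : Fin 4 → k)] := by
    have h1 := b.linearIndependent.map' W.subtype W.ker_subtype
    rwa [show (W.subtype ∘ b : Fin 2 → Fin 4 → k) = ![(b 0 : Fin 4 → k), (b 1 : Fin 4 → k)] by
      funext i
      fin_cases i <;> rfl] at h1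
  have h := hline (b 0) (b 0).2 (b 1) (b 1).2
  rw [aeval_diagonalForm] at h
  set u : Fin 4 → k := (b 0 : Fin 4 → k)
  set v : Fin 4 → k := (b 1 : Fin 4 → k)
  rw [MvPolynomial.algebraMap_eq] at h
  rw [LinearIndependent.pair_iff] at hli
  obtain ⟨i, m, him⟩ : ∃ i m, u i * v m ≠ u m * v i := by
    by_contra! hcon
    have hu (i : Fin 4) : u i = 0 := by
      have := (hli (v i) (-u i) (by
        ext m
        simp only [Pi.add_apply, Pi.smul_apply, smul_eq_mul, Pi.zero_apply]
        linear_combination -hcon i m)).2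
      simpa using this
    have := (hli 1 0 (by ext m; simp [hu m])).1
    exact one_ne_zero this
  have hpi : u i ≠ 0 ∨ v i ≠ 0 := by
    by_contra! h0
    simp [h0.1, h0.2] at him
  have hpm : u m ≠ 0 ∨ v m ≠ 0 := by
    by_contra! h0
    simp [h0.1, h0.2] at him
  obtain ⟨j, hji, hpj, hij⟩ := exists_ne_proportional hd h i (a i).ne_zero hpi
  obtain ⟨n, hnm, hpn, hmn⟩ := exists_ne_proportional hd h m (a m).ne_zero hpm
  have hmi : m ≠ i := by
    rintro rfl
    exact him rfl
  have hjm : j ≠ m := by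
    rintro rfl
    exact him hij
  have hni : n ≠ i := by
    rintro rfl
    exact him hmn.symm
  have hjn : j ≠ n := by
    rintro rfl
    apply him
    rcases hpj with hp | hp
    · apply mul_left_cancel₀ hp
      linear_combination (-u i) * hmn + u m * hij
    · apply mul_left_cancel₀ hp
      linear_combination (-v i) * hmn + v m * hij
  have hall : ∀ x, x = i ∨ x = j ∨ x = m ∨ x = n := 
    forall_eq_of_pairwise_ne i j m n hji.symm hmi.symm hni.symm hjm hjn hnm.symm
  refine ⟨i, j, m, n, ⟨hji.symm, hmi.symm, hni.symm, hjm, hjn, hnm.symm⟩,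
    exists_add_mul_pow_eq_zero (by omega) h hall hji hij hmn him,
    exists_add_mul_pow_eq_zero (by omega) h (j := n) (m := i) (n := j)
      (forall_eq_of_pairwise_ne m n i j hnm.symm hmi hjm.symm hni hjn.symm hji.symm)
      hnm hmn hij him.symm⟩

/-- The coefficients `1, -A, -B, AB`, for which the surface contains a line over any field in which
`A` or `B` is a `d`-th power. -/
def pairedCoeffs {k : Type*} [Field k] (A B : kˣ) : Fin 4 → kˣ := ![1, -A, -B, A * B]

/-- A line over `k` on the surface with coefficients `1, -A, -B, AB` makes `A`, `B` or `-AB` a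
`d`-th power. -/
theorem isPow_of_containsLineOver {k : Type*} [Field k] [CharZero k] {d : ℕ} (hd : 3 ≤ d)
    (A B : kˣ) (h : ContainsLineOver (diagonalForm d (pairedCoeffs A B)) k) :
    ∃ t : k, (A : k) = t ^ d ∨ (B : k) = t ^ d ∨ -(A * B : k) = t ^ d := by
  obtain ⟨i, j, m, n, hne, h1, h2⟩ := exists_pairs_of_containsLineOver hd _ h
  have hsymm : ∀ x y : Fin 4, (∃ t : k, (pairedCoeffs A B x : k) + pairedCoeffs A B y * t ^ d = 0) →
      ∃ t : k, (pairedCoeffs A B y : k) + pairedCoeffs A B x * t ^ d = 0 := by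
    rintro x y ⟨t, ht⟩
    have ht0 : t ≠ 0 := by
      rintro rfl
      rw [zero_pow (by omega), mul_zero, add_zero] at ht
      exact (pairedCoeffs A B x).ne_zero ht
    refine ⟨t⁻¹, ?_⟩
    rw [inv_pow]
    field_simp
    linear_combination ht
  obtain ⟨x, hx, t, ht⟩ : ∃ x : Fin 4, x ≠ 0 ∧
      ∃ t : k, (pairedCoeffs A B x : k) + pairedCoeffs A B 0 * t ^ d = 0 := by
    obtain ⟨hij, him, hin, hjm, hjn, hmn⟩ := hne
    have h0 := forall_eq_of_pairwise_ne i j m n hij him hin hjm hjn hmn 0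
    simp only [eq_comm (a := (0 : Fin 4))] at h0
    rcases h0 with rfl | rfl | rfl | rfl
    · exact ⟨j, hij.symm, hsymm _ _ h1⟩
    · exact ⟨i, hij, h1⟩
    · exact ⟨n, hmn.symm, hsymm _ _ h2⟩
    · exact ⟨m, hmn, h2⟩
  refine ⟨t, ?_⟩
  fin_cases x
  · exact absurd rfl hx
  · left
    simp [pairedCoeffs] at ht
    linear_combination -ht
  · right; left
    simp [pairedCoeffs] at ht
    linear_combination -ht
  · right; right
    simp [pairedCoeffs] at ht
    linear_combination -ht

/-- Up to the order of the coordinates, the relations `a₀ α ^ d + a₁ = 0` and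
`a₂ α ^ d + a₃ = 0` give the line `x₀ = α x₁`, `x₂ = α x₃`. -/
theorem containsLineOver_of_perm {k K : Type*} [Field k] [Field K] [Algebra k K] {d : ℕ}
    (a : Fin 4 → kˣ) (e : Equiv.Perm (Fin 4)) (α : K)
    (h1 : algebraMap k K (a (e 0)) * α ^ d + algebraMap k K (a (e 1)) = 0)
    (h2 : algebraMap k K (a (e 2)) * α ^ d + algebraMap k K (a (e 3)) = 0) :
    ContainsLineOver (diagonalForm d a) K := by
  let f : (Fin 2 → K) →ₗ[K] (Fin 4 → K) :=
    { toFun := fun x i => ![α * x 0, x 0, α * x 1, x 1] (e.symm i)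
      map_add' := by
        intro x y
        ext i
        simp only [Pi.add_apply]
        generalize e.symm i = j
        fin_cases j <;> simp [mul_add]
      map_smul' := by
        intro c x
        ext i
        simp only [Pi.smul_apply]
        generalize e.symm i = j
        fin_cases j <;> simp [mul_left_comm] }
  have hf : Function.Injective f := by
    intro x y hxy
    have h1 := congrFun hxy (e 1)
    have h3 := congrFun hxy (e 3)
    simp [f] at h1 h3
    ext i
    fin_cases i
    · exact h1
    · exact h3
  refine ⟨LinearMap.range f, by simp [LinearMap.finrank_range_of_inj hf], ?_⟩
  rintro _ ⟨x, rfl⟩ _ ⟨y, rfl⟩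
  rw [aeval_diagonalForm, ← Equiv.sum_comp e, Fin.sum_univ_four]
  simp only [f, LinearMap.coe_mk, AddHom.coe_mk, Equiv.symm_apply_apply, Matrix.cons_val]
  simp only [IsScalarTower.algebraMap_apply k K (MvPolynomial (Fin 2) K),
    MvPolynomial.algebraMap_eq]
  have h3 := congrArg (C (σ := Fin 2)) h1
  have h4 := congrArg (C (σ := Fin 2)) h2
  simp only [map_add, map_mul, map_pow, map_zero] at h3 h4 ⊢
  have h5 (p q : K) : (C α * C p * X 0 + C α * C q * X 1 : MvPolynomial (Fin 2) K) =
    C α * (C p * X 0 + C q * X 1) := by ring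
  rw [h5, h5, mul_pow, mul_pow]
  linear_combination (C (x 0) * X 0 + C (y 0) * X 1) ^ d * h3 +
    (C (x 1) * X 0 + C (y 1) * X 1) ^ d * h4

theorem containsLineOver_of_isPow {k K : Type*} [Field k] [Field K] [Algebra k K] {d : ℕ}
    (A B : kˣ) (h : ∃ t : K, algebraMap k K A = t ^ d ∨ algebraMap k K B = t ^ d) :
    ContainsLineOver (diagonalForm d (pairedCoeffs A B)) K := by
  obtain ⟨t, h | h⟩ := h
  · refine containsLineOver_of_perm _ 1 t ?_ ?_ <;> simp [pairedCoeffs, h]; ring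
  · refine containsLineOver_of_perm _ (Equiv.swap 1 2) t ?_ ?_
    · rw [Equiv.swap_apply_left, Equiv.swap_apply_of_ne_of_ne (by decide) (by decide)]
      simp [pairedCoeffs, h]
    · rw [Equiv.swap_apply_right, Equiv.swap_apply_of_ne_of_ne (by decide) (by decide)]
      simp [pairedCoeffs, h]

end Lines

/-! ### The coefficient that is a power wherever there are roots of unity -/

section Kummer

universe u

open Polynomial

/-- Complex conjugation induces an element of order `2` of the Galois group, as `k` is totally
real. -/
theorem even_card_gal_cyclotomicField {k : Type*} [Field k] [NumberField k] [IsTotallyReal k]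
    {ℓ : ℕ} [Fact ℓ.Prime] (hℓ : ℓ ≠ 2) : Even (Nat.card Gal(CyclotomicField ℓ k/k)) := by
  let M := CyclotomicField ℓ k
  have : NeZero ℓ := ⟨(Fact.out : ℓ.Prime).ne_zero⟩
  have : NumberField M := IsCyclotomicExtension.numberField {ℓ} k M
  have : IsGalois k M := IsCyclotomicExtension.isGalois {ℓ} k M
  have hζ := IsCyclotomicExtension.zeta_spec ℓ k M
  set ζ := IsCyclotomicExtension.zeta ℓ k M
  obtain ⟨φ⟩ : Nonempty (M →+* ℂ) := inferInstance
  have hφ : φ.comp (algebraMap k M) = ((starRingEnd ℂ).comp φ).comp (algebraMap k M) := by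
    have := IsTotallyReal.complexEmbedding_isReal (φ.comp (algebraMap k M))
    exact (ComplexEmbedding.isReal_iff.1 this).symm
  obtain ⟨σ, hσ⟩ := ComplexEmbedding.exists_comp_symm_eq_of_comp_eq φ _ hφ
  have hσ' (x : M) : φ (σ.symm x) = starRingEnd ℂ (φ x) := RingHom.congr_fun hσ x
  have h2 : σ.symm ^ 2 = 1 := by
    ext x
    apply φ.injective
    rw [pow_two, AlgEquiv.mul_apply, hσ', hσ', Complex.conj_conj, AlgEquiv.one_apply]
  have h1 : σ.symm ≠ 1 := by
    intro h
    have h3 := hσ' ζ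
    rw [h, AlgEquiv.one_apply] at h3
    obtain ⟨x, hx⟩ := Complex.conj_eq_iff_real.1 h3.symm
    have hodd : Odd ℓ := (Fact.out : ℓ.Prime).odd_of_ne_two hℓ
    have h4 : x ^ ℓ = 1 ^ ℓ := by
      have : φ ζ ^ ℓ = 1 := by rw [← map_pow, hζ.pow_eq_one, map_one]
      rw [hx] at this
      rw [one_pow]
      exact_mod_cast this
    have h5 : x = 1 := hodd.strictMono_pow.injective h4
    rw [h5, Complex.ofReal_one, ← map_one φ] at hx
    exact hζ.ne_one (Fact.out : ℓ.Prime).one_lt (φ.injective hx)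
  have := orderOf_dvd_natCard σ.symm
  rw [orderOf_eq_prime h2 h1] at this
  exact even_iff_two_dvd.2 this

/-- If `k` is totally real and `ℓ` is an odd prime, then `k(ζ_ℓ)` contains a quadratic extension
`k(√D)` of `k`: the extension is cyclic of even order, so a generator of its Galois group has the
eigenvalue `-1`, and the square of an eigenvector serves as `D`. -/
theorem exists_not_isSquare_of_isPrimitiveRoot (k : Type*) [Field k] [NumberField k]
    [IsTotallyReal k] {ℓ : ℕ} (hp : ℓ.Prime) (hℓ : ℓ ≠ 2) :
    ∃ D : k, ¬ IsSquare D ∧ ∀ (K : Type*) [Field K] [Algebra k K] (ζ : K), IsPrimitiveRoot ζ ℓ →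
      IsSquare (algebraMap k K D) := by
  have : Fact ℓ.Prime := ⟨hp⟩
  let M := CyclotomicField ℓ k
  have : NeZero ℓ := ⟨hp.ne_zero⟩
  have : IsGalois k M := IsCyclotomicExtension.isGalois {ℓ} k M
  have : FiniteDimensional k M := IsCyclotomicExtension.finiteDimensional {ℓ} k M
  have hζ := IsCyclotomicExtension.zeta_spec ℓ k M
  have : IsCyclic Gal(M/k) := isCyclic_of_injective _ (hζ.autToPow_injective k)
  obtain ⟨g, hg⟩ := IsCyclic.exists_generator (α := Gal(M/k))
  have hg2 : Even (orderOf g) := by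
    rw [orderOf_eq_card_of_forall_mem_zpowers hg]
    exact even_card_gal_cyclotomicField hℓ
  have hroot : (minpoly k g.toLinearMap).IsRoot (-1) := by
    simp [minpoly_algEquiv_toLinearMap g (isOfFinOrder_of_finite g), hg2.neg_one_pow]
  obtain ⟨y, hy⟩ := (Module.End.hasEigenvalue_of_isRoot hroot).exists_hasEigenvector
  have hy0 : y ≠ 0 := hy.2
  have hgy : g y = -y := by simpa using hy.apply_eq_smul
  have hfix (f : Gal(M/k)) : f (y ^ 2) = y ^ 2 := by
    have hmem : g ∈ MulAction.stabilizer Gal(M/k) (y ^ 2) := by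
      rw [MulAction.mem_stabilizer_iff, AlgEquiv.smul_def, map_pow, hgy, neg_sq]
    exact (Subgroup.zpowers_le.2 hmem) (hg f)
  obtain ⟨D, hD⟩ := (IsGalois.mem_range_algebraMap_iff_fixed (F := k) (y ^ 2)).2 hfix
  refine ⟨D, ?_, ?_⟩
  · rintro ⟨c, rfl⟩
    have h1 : (y - algebraMap k M c) * (y + algebraMap k M c) = 0 := by
      rw [map_mul] at hD
      linear_combination -hD
    obtain ⟨e, he⟩ : ∃ e : k, y = algebraMap k M e := by
      rcases mul_eq_zero.1 h1 with h | h
      · exact ⟨c, by linear_combination h⟩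
      · exact ⟨-c, by rw [map_neg]; linear_combination h⟩
    rw [he, AlgEquiv.commutes] at hgy
    rw [he] at hy0
    have h2 : (2 : M) * algebraMap k M e = 0 := by linear_combination hgy
    exact hy0 ((mul_eq_zero.1 h2).resolve_left two_ne_zero)
  · intro K _ _ ζ hζK
    have hsplit : ((cyclotomic ℓ k).map (algebraMap k K)).Splits := by
      rw [map_cyclotomic]
      exact (X_pow_sub_one_splits hζK).of_dvd (X_pow_sub_C_ne_zero hp.pos _)
        (cyclotomic.dvd_X_pow_sub_one ℓ K)
    let ψ : M →ₐ[k] K := SplittingField.lift (cyclotomic ℓ k) hsplit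
    refine ⟨ψ y, ?_⟩
    rw [← ψ.commutes, hD, map_pow, pow_two]

theorem exists_ringHom_real (k : Type*) [Field k] [NumberField k] [IsTotallyReal k] :
    Nonempty (k →+* ℝ) := by
  obtain ⟨v⟩ : Nonempty (InfinitePlace k) := inferInstance
  exact ⟨InfinitePlace.embedding_of_isReal (IsTotallyReal.isReal v)⟩

/-- The coordinates of `ζ = (y + i z) / 2`, a root of unity with `ζ ^ 2 ^ r = -1`, such that `y`
and `z` lie in `k`, though `i` need not. The condition on `ζ` is imposed in every extension of `k`
that contains a square root `i` of `-1`. -/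
def IsHalfAngle {k : Type u} [Field k] (r : ℕ) (y z : k) : Prop :=
  y ^ 2 + z ^ 2 = 4 ∧ z ≠ 0 ∧ ∀ (K : Type u) [Field K] [Algebra k K] (i : K), i ^ 2 = -1 →
    ((algebraMap k K y + i * algebraMap k K z) / 2) ^ 2 ^ r = -1

theorem isHalfAngle_zero_two {k : Type u} [Field k] [CharZero k] :
    IsHalfAngle 1 (0 : k) 2 := by
  refine ⟨by norm_num, two_ne_zero, fun K _ _ i hi => ?_⟩
  have : CharZero K := charZero_of_injective_algebraMap (algebraMap k K).injective
  simp [map_ofNat, hi]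

/-- The half-angle formulas: if `2 + y` is a square in `k`, one more halving of the angle stays
in `k`. -/
theorem IsHalfAngle.succ {k : Type u} [Field k] [CharZero k] {r : ℕ} {y z w : k}
    (h : IsHalfAngle r y z) (hw : 2 + y = w ^ 2) : IsHalfAngle (r + 1) w (z / w) := by
  obtain ⟨h1, h2, h3⟩ := h
  have hz : z ^ 2 = (2 - y) * w ^ 2 := by
    rw [← hw]
    linear_combination h1
  have hw0 : w ≠ 0 := by
    rintro rfl
    simp at hz
    exact h2 hz
  refine ⟨?_, div_ne_zero h2 hw0, fun K _ _ i hi => ?_⟩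
  · rw [div_pow, hz]
    field_simp
    linear_combination -hw
  · rw [pow_succ', pow_mul, ← h3 K i hi]
    congr 1
    have : CharZero K := charZero_of_injective_algebraMap (algebraMap k K).injective
    have hz' : z / w * w = z := div_mul_cancel₀ z hw0
    have hzz : (z / w) ^ 2 = 2 - y := by rw [div_pow, hz]; field_simp
    have e1 := congrArg (algebraMap k K) hz'
    have e2 := congrArg (algebraMap k K) hzz
    have e3 := congrArg (algebraMap k K) hw
    simp only [map_mul, map_pow, map_add, map_sub, map_ofNat] at e1 e2 e3
    rw [div_pow]
    field_simp
    linear_combination 2 * i * e1 - e3 + i ^ 2 * e2 + (2 - algebraMap k K y) * hi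

theorem IsHalfAngle.two_add_pos {k : Type u} [Field k] {r : ℕ} {y z : k}
    (h : IsHalfAngle r y z) (φ : k →+* ℝ) : 0 < φ (2 + y) := by
  have h1 := congrArg φ h.1
  have h2 : φ z ≠ 0 := (map_ne_zero φ).2 h.2.1
  have h3 : 0 < φ z ^ 2 := by positivity
  simp only [map_add, map_pow, map_ofNat] at h1 ⊢
  nlinarith

/-- `2 + y = (1 + ζ) ^ 2 / ζ` for `ζ = (y + i z) / 2`, a number of norm `1`. -/
theorem IsHalfAngle.pow_mul_pow_eq {k : Type u} [Field k] [CharZero k] {r : ℕ} {y z : k}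
    (h : IsHalfAngle r y z) {K : Type u} [Field K] [Algebra k K] {i : K} (hi : i ^ 2 = -1) :
    ∃ ζ : K, ζ ^ 2 ^ r = -1 ∧ ∀ n : ℕ,
      algebraMap k K (2 + y) ^ n * ζ ^ n = (1 + ζ) ^ (2 * n) := by
  have : CharZero K := charZero_of_injective_algebraMap (algebraMap k K).injective
  refine ⟨_, h.2.2 K i hi, fun n => ?_⟩
  rw [pow_mul, ← mul_pow]
  congr 1
  have h1 := congrArg (algebraMap k K) h.1
  simp only [map_add, map_pow, map_ofNat] at h1 ⊢
  field_simp
  linear_combination h1 - algebraMap k K z ^ 2 * hi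

/-- For `4 ∣ d` there is `B ∈ k` that is not a `d`-th power in `k`, but is one as soon as `-1` is
a square. Halving the angle repeatedly from `2cos(π / 2) = 0` gives `y = 2cos(π / 2 ^ r)` in `k`. If
`2 + y` is not a square for some `2 ^ (r + 1) ∣ d / 2`, then `B = (2 + y) ^ (d / 2)` will do;
otherwise the process goes on until `B = -(2 + y) ^ (d / 2)` will do. -/
theorem exists_not_isPow_of_four_dvd (k : Type u) [Field k] [NumberField k] [IsTotallyReal k]
    {d : ℕ} (hd0 : d ≠ 0) (hd : 4 ∣ d) : ∃ B : k, B ≠ 0 ∧ (¬ ∃ t : k, B = t ^ d) ∧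
      ∀ (K : Type u) [Field K] [Algebra k K] (i : K), i ^ 2 = -1 →
        ∃ t : K, algebraMap k K B = t ^ d := by
  obtain ⟨φ⟩ := exists_ringHom_real k
  obtain ⟨m, e, he, hde⟩ := Nat.exists_eq_two_pow_mul_odd hd0
  obtain ⟨m, rfl⟩ : ∃ m', m = m' + 2 := by
    refine Nat.exists_eq_add_of_le' ?_
    have h4 : 2 ^ 2 ∣ 2 ^ m * e := hde ▸ hd
    have := (Nat.Coprime.dvd_of_dvd_mul_right (Nat.Coprime.pow_left 2
      (Nat.coprime_two_left.2 he)) h4)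
    exact (Nat.pow_dvd_pow_iff_le_right (by norm_num)).1 this
  have hd2 : d = 2 * (2 ^ (m + 1) * e) := by rw [hde]; ring
  -- `s` is the number of halvings left before `ζ ^ (d / 2) = -1`
  suffices H : ∀ s r : ℕ, r + s = m + 1 → ∀ y z : k, IsHalfAngle r y z →
      ∃ B : k, B ≠ 0 ∧ (¬ ∃ t : k, B = t ^ d) ∧
        ∀ (K : Type u) [Field K] [Algebra k K] (i : K), i ^ 2 = -1 →
          ∃ t : K, algebraMap k K B = t ^ d from
    H m 1 (by omega) 0 2 isHalfAngle_zero_two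
  intro s
  induction s with
  | zero =>
    intro r hr y z h
    have hr' : r = m + 1 := by omega
    subst hr'
    have hy := h.two_add_pos φ
    refine ⟨-(2 + y) ^ (2 ^ (m + 1) * e), ?_, ?_, fun K _ _ i hi => ?_⟩
    · refine neg_ne_zero.2 (pow_ne_zero _ ?_)
      intro h0
      simp [h0] at hy
    · rintro ⟨t, ht⟩
      have h1 := congrArg φ ht
      rw [map_neg, map_pow, map_pow] at h1
      have h2 := pow_pos hy (2 ^ (m + 1) * e)
      have h3 : 0 ≤ φ t ^ d := Even.pow_nonneg (by rw [hd2]; exact even_two_mul _) _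
      linarith
    · obtain ⟨ζ, hζ, hpow⟩ := h.pow_mul_pow_eq hi
      refine ⟨1 + ζ, ?_⟩
      have h1 := hpow (2 ^ (m + 1) * e)
      rw [pow_mul ζ, hζ, he.neg_one_pow, ← hd2] at h1
      rw [← h1, map_neg, map_pow]
      ring
  | succ s ih =>
    intro r hr y z h
    by_cases hsq : ∃ w, 2 + y = w ^ 2
    · obtain ⟨w, hw⟩ := hsq
      exact ih (r + 1) (by omega) _ _ (h.succ hw)
    have hy := h.two_add_pos φ
    refine ⟨(2 + y) ^ (2 ^ (m + 1) * e), ?_, ?_, fun K _ _ i hi => ?_⟩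
    · refine pow_ne_zero _ ?_
      intro h0
      simp [h0] at hy
    · rintro ⟨t, ht⟩
      refine hsq ⟨t, φ.injective ?_⟩
      have h1 : φ (2 + y) ^ (2 ^ (m + 1) * e) = φ (t ^ 2) ^ (2 ^ (m + 1) * e) := by
        rw [← map_pow, ← map_pow, ht, ← pow_mul, ← hd2]
      refine (pow_left_inj₀ hy.le ?_ ?_).1 h1
      · rw [map_pow]; positivity
      · have := he.pos
        positivity
    · obtain ⟨ζ, hζ, hpow⟩ := h.pow_mul_pow_eq hi
      refine ⟨1 + ζ, ?_⟩
      have h1 := hpow (2 ^ (m + 1) * e)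
      have h2 : 2 ^ (m + 1) * e = 2 ^ r * (2 * (2 ^ s * e)) := by
        rw [← hr]; ring
      have h3 : ζ ^ (2 ^ (m + 1) * e) = 1 := by
        rw [h2, pow_mul, hζ, (even_two_mul _).neg_one_pow]
      rw [h3, ← hd2, mul_one] at h1
      rw [map_pow, h1]

/-- For `d ≡ 2` mod `4` and an odd prime `ℓ`, there is `B ∈ k` that is not a `d`-th power in `k`,
but is one as soon as there is a primitive `ℓ`-th root of unity: `B = D ^ (d / 2)`, where `k(√D)`
is a quadratic extension of `k` contained in `k(ζ_ℓ)`. Here `d = 2 * e`. -/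
theorem exists_not_isPow_of_isPrimitiveRoot (k : Type u) [Field k] [NumberField k]
    [IsTotallyReal k] {e ℓ : ℕ} (he : Odd e) (hp : ℓ.Prime) (hℓ : ℓ ≠ 2) :
    ∃ B : k, B ≠ 0 ∧ (¬ ∃ t : k, B = t ^ (2 * e)) ∧
      ∀ (K : Type u) [Field K] [Algebra k K] (ζ : K), IsPrimitiveRoot ζ ℓ →
        ∃ t : K, algebraMap k K B = t ^ (2 * e) := by
  obtain ⟨φ⟩ := exists_ringHom_real k
  obtain ⟨D, hD, hK⟩ := exists_not_isSquare_of_isPrimitiveRoot k hp hℓ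
  refine ⟨D ^ e, pow_ne_zero _ ?_, ?_, fun K _ _ ζ hζ => ?_⟩
  · rintro rfl
    exact hD ⟨0, by simp⟩
  · rintro ⟨t, ht⟩
    refine hD ⟨t, φ.injective ?_⟩
    rw [pow_mul] at ht
    have h1 := congrArg φ ht
    rw [map_pow, map_pow] at h1
    rw [← pow_two]
    exact he.strictMono_pow.injective h1
  · obtain ⟨t, ht⟩ := hK K ζ hζ
    exact ⟨t, by rw [map_pow, ht, ← pow_two, pow_mul]⟩

end Kummer

/-! ### Hensel's lemma in the completions -/

section Hensel

open Polynomial Filter Topology WithZero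

variable {R : Type*} [CommRing R] [IsDedekindDomain R]

/-- One step of Newton's method, modulo powers of a prime ideal. -/
theorem exists_newton_step (v : HeightOneSpectrum R) (f : R[X]) {x : R} {n : ℕ}
    (h : f.eval x ∈ v.asIdeal ^ (n + 1)) (h' : f.derivative.eval x ∉ v.asIdeal) :
    ∃ y : R, f.eval y ∈ v.asIdeal ^ (n + 2) ∧ y - x ∈ v.asIdeal ^ (n + 1) := by
  obtain ⟨b, c, hc, hb⟩ := v.isMaximal.exists_inv h'
  obtain ⟨q, hq⟩ := f.binomExpansion x (-(b * f.eval x))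
  refine ⟨x + -(b * f.eval x), ?_, ?_⟩
  · rw [hq]
    have h1 : f.eval x * c ∈ v.asIdeal ^ (n + 2) := by
      rw [pow_succ _ (n + 1)]
      exact Ideal.mul_mem_mul h hc
    have h2 : f.eval x * f.eval x ∈ v.asIdeal ^ (n + 2) :=
      Ideal.pow_le_pow_right (by omega : n + 2 ≤ (n + 1) + (n + 1))
        (by rw [pow_add]; exact Ideal.mul_mem_mul h h)
    have h3 := Ideal.add_mem _ h1 (Ideal.mul_mem_left _ (q * b ^ 2) h2)
    convert h3 using 1
    linear_combination -f.eval x * hb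
  · rw [add_sub_cancel_left]
    exact (Ideal.neg_mem_iff _).2 (Ideal.mul_mem_left _ b h)

variable (K : Type*) [Field K] [Algebra R K] [IsFractionRing R K]

theorem tendsto_algebraMap_adicCompletion_zero (v : HeightOneSpectrum R) {w : ℕ → R}
    (hw : ∀ n, w n ∈ v.asIdeal ^ n) :
    Tendsto (fun n => algebraMap R (v.adicCompletion K) (w n)) atTop (𝓝 0) := by
  rw [(Valued.hasBasis_nhds_zero (v.adicCompletion K) ℤᵐ⁰).tendsto_right_iff]
  intro γ _
  have hval (n : ℕ) : Valued.v (algebraMap R (v.adicCompletion K) (w n)) ≤ exp (-(n : ℤ)) := by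
    have h1 := HeightOneSpectrum.valuedAdicCompletion_eq_valuation (K := K) v (w n)
    have h2 := (v.intValuation_le_pow_iff_mem (w n) n).2 (hw n)
    rw [← v.valuation_of_algebraMap (K := K)] at h2
    exact h1.trans_le h2
  have hγ : MonoidWithZeroHom.ValueGroup₀.embedding γ.1 ≠ (0 : ℤᵐ⁰) := by
    simp
  obtain ⟨z, hz⟩ : ∃ z : ℤ, exp z = MonoidWithZeroHom.ValueGroup₀.embedding γ.1 :=
    ⟨log _, exp_log hγ⟩
  filter_upwards [eventually_gt_atTop (-z).toNat] with n hn
  rw [Valuation.restrict_lt_iff_lt_embedding, ← hz]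
  refine (hval n).trans_lt (exp_lt_exp.2 ?_)
  omega

theorem nonarchimedeanRing_adicCompletion (v : HeightOneSpectrum R) :
    NonarchimedeanRing (v.adicCompletion K) := by
  convert! (Valued.v (R := v.adicCompletion K)).subgroups_basis.nonarchimedean
  exact congrArg (fun U => U.toTopologicalSpace)
    (Valued.toUniformSpace_eq (v.adicCompletion K) ℤᵐ⁰)

/-- Hensel's lemma: a simple root of `f` modulo a prime ideal lifts to the completion. -/
theorem exists_aeval_eq_zero_adicCompletion (v : HeightOneSpectrum R) (f : R[X]) {a : R}
    (h : f.eval a ∈ v.asIdeal) (h' : f.derivative.eval a ∉ v.asIdeal) :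
    ∃ x : v.adicCompletion K, aeval x f = 0 := by
  let S : ℕ → Type _ := fun n => {x : R // f.eval x ∈ v.asIdeal ^ (n + 1) ∧
    f.derivative.eval x ∉ v.asIdeal}
  have step (n : ℕ) (x : S n) : ∃ y : S (n + 1), y.1 - x.1 ∈ v.asIdeal ^ (n + 1) := by
    obtain ⟨y, hy1, hy2⟩ := exists_newton_step v f x.2.1 x.2.2
    refine ⟨⟨y, hy1, fun hy => x.2.2 ?_⟩, hy2⟩
    have h1 : y - x.1 ∈ v.asIdeal := Ideal.pow_le_self (Nat.succ_ne_zero n) hy2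
    have h2 := v.asIdeal.mem_of_dvd (sub_dvd_eval_sub y x.1 f.derivative) h1
    simpa using v.asIdeal.sub_mem hy h2
  choose g hg using step
  let x : (n : ℕ) → S n := fun n =>
    Nat.rec (motive := S) ⟨a, by simpa using h, h'⟩ (fun n s => g n s) n
  let ι := algebraMap R (v.adicCompletion K)
  have hcauchy : CauchySeq fun n => ι (x n).1 := by
    have := nonarchimedeanRing_adicCompletion K v
    refine NonarchimedeanAddGroup.cauchySeq_of_tendsto_sub_nhds_zero ?_
    simp only [← map_sub]
    exact tendsto_algebraMap_adicCompletion_zero K v fun n =>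
      Ideal.pow_le_pow_right (Nat.le_succ n) (hg n (x n))
  obtain ⟨z, hz⟩ := cauchySeq_tendsto_of_complete hcauchy
  refine ⟨z, ?_⟩
  have h1 : Tendsto (fun n => aeval (ι (x n).1) f) atTop (𝓝 (aeval z f)) :=
    ((Polynomial.continuous_aeval f).tendsto z).comp hz
  have h2 : Tendsto (fun n => aeval (ι (x n).1) f) atTop (𝓝 0) := by
    simp only [ι, aeval_algebraMap_apply_eq_algebraMap_eval]
    exact tendsto_algebraMap_adicCompletion_zero K v fun n =>
      Ideal.pow_le_pow_right (Nat.le_succ n) (x n).2.1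
  exact tendsto_nhds_unique h1 h2

end Hensel

/-! ### Local powers -/

section Local

open Polynomial

/-- The cyclotomic polynomial has only simple roots modulo a prime ideal not containing `N`. -/
theorem derivative_cyclotomic_eval_notMem {R : Type*} [CommRing R] {P : Ideal R} [hP : P.IsPrime]
    {N : ℕ} (hN : (N : R) ∉ P) {a : R} (ha : (cyclotomic N R).eval a ∈ P) :
    (cyclotomic N R).derivative.eval a ∉ P := by
  intro h
  obtain ⟨g, hg⟩ := cyclotomic.dvd_X_pow_sub_one N R
  have hN0 : N ≠ 0 := by
    rintro rfl
    simp at hN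
  have h1 := congrArg (eval a) hg
  have h2 := congrArg (fun p => eval a (derivative p)) hg
  simp only [eval_sub, eval_pow, eval_X, eval_one, eval_mul] at h1
  simp only [derivative_sub, derivative_X_pow, derivative_one, sub_zero, derivative_mul,
    eval_mul, eval_add, eval_pow, eval_X, eval_C] at h2
  have h3 : (N : R) * a ^ (N - 1) ∈ P := by
    rw [h2]
    exact P.add_mem (P.mul_mem_right _ h) (P.mul_mem_right _ ha)
  have h4 : a ∈ P := hP.mem_of_pow_mem _ ((hP.mem_or_mem h3).resolve_left hN)
  have h5 : (1 : R) ∈ P := by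
    have := P.sub_mem (P.pow_mem_of_mem h4 N (Nat.pos_of_ne_zero hN0))
      (P.mul_mem_right (eval a g) ha)
    rwa [← h1, sub_sub_cancel] at this
  exact hP.ne_top ((Ideal.eq_top_iff_one P).2 h5)

theorem exists_cyclotomic_eval_eq {R : Type*} [CommRing R] {N : ℕ} (hN : 2 ≤ N) (y : R) :
    ∃ w, (cyclotomic N R).eval y = 1 + y * w := by
  have h := sub_dvd_eval_sub y 0 (cyclotomic N R)
  rw [sub_zero, ← coeff_zero_eq_eval_zero, cyclotomic_coeff_zero R hN] at h
  obtain ⟨w, hw⟩ := h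
  exact ⟨w, by linear_combination hw⟩

variable {R : Type*} [CommRing R] [IsDedekindDomain R] (K : Type*) [Field K] [Algebra R K]
  [IsFractionRing R K] (v : HeightOneSpectrum R)

theorem charZero_adicCompletion [CharZero K] : CharZero (v.adicCompletion K) :=
  charZero_of_injective_algebraMap (algebraMap K (v.adicCompletion K)).injective

theorem exists_isPrimitiveRoot_adicCompletion [CharZero K] {N : ℕ} (hN : (N : R) ∉ v.asIdeal) {a : R}
    (ha : (cyclotomic N R).eval a ∈ v.asIdeal) :
    ∃ ζ : v.adicCompletion K, IsPrimitiveRoot ζ N := by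
  have := charZero_adicCompletion K v
  obtain ⟨ζ, hζ⟩ := exists_aeval_eq_zero_adicCompletion K v _ ha
    (derivative_cyclotomic_eval_notMem hN ha)
  have : NeZero N := ⟨by rintro rfl; simp at hN⟩
  refine ⟨ζ, isRoot_cyclotomic_iff.1 ?_⟩
  rwa [IsRoot, ← map_cyclotomic N (algebraMap R _), eval_map_algebraMap]

theorem exists_pow_eq_of_pow_sub_mem {n : ℕ} (hn : (n : R) ∉ v.asIdeal) {s a : R}
    (hs : s ∉ v.asIdeal) (ha : a ^ n - s ∈ v.asIdeal) :
    ∃ t : v.adicCompletion K, algebraMap K _ (algebraMap R K s) = t ^ n := by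
  have hn0 : n ≠ 0 := by
    rintro rfl
    simp at hn
  have hav : a ∉ v.asIdeal := by
    intro h
    apply hs
    have := v.asIdeal.sub_mem (v.asIdeal.pow_mem_of_mem h n (Nat.pos_of_ne_zero hn0)) ha
    rwa [sub_sub_cancel] at this
  obtain ⟨t, ht⟩ := exists_aeval_eq_zero_adicCompletion K v (X ^ n - C s) (a := a)
    (by simpa using ha) (by
      simp only [derivative_sub, derivative_X_pow, derivative_C, sub_zero, eval_mul, eval_C,
        eval_pow, eval_X]
      exact fun h => ((v.isPrime.mem_or_mem h).resolve_left hn |> v.isPrime.mem_of_pow_mem _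
        |> hav))
  refine ⟨t, ?_⟩
  rw [← IsScalarTower.algebraMap_apply]
  simp only [map_sub, map_pow, aeval_X, aeval_C] at ht
  linear_combination -ht

/-- Elements congruent to `1` modulo `n ^ 3` are `n`-th powers at the primes dividing `n`: write
`(1 + n ^ 2 X) ^ n = 1 + n ^ 3 (X + n X ^ 2 q)` and solve `X + n X ^ 2 q = w`, which has a simple
root modulo `n`. -/
theorem exists_pow_eq_of_mem {n : ℕ} (hn : (n : R) ∈ v.asIdeal) (w : R) :
    ∃ t : v.adicCompletion K, algebraMap K _ (algebraMap R K (1 + n ^ 3 * w)) = t ^ n := by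
  obtain ⟨q, hq⟩ := (X ^ n : R[X][X]).binomExpansion 1 ((n : R[X]) ^ 2 * X)
  simp only [eval_pow, eval_X, derivative_X_pow, eval_mul, eval_C, one_pow, mul_one] at hq
  let f : R[X] := X + (n : R[X]) * (X ^ 2 * q) - C w
  have hf : (1 + (n : R[X]) ^ 2 * X) ^ n = 1 + (n : R[X]) ^ 3 * (f + C w) := by
    rw [hq]
    simp only [f]
    ring
  obtain ⟨z, hz⟩ := exists_aeval_eq_zero_adicCompletion K v f (a := w)
    (by
      have : f.eval w = n * eval w (X ^ 2 * q) := by simp [f]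
      rw [this]
      exact v.asIdeal.mul_mem_right _ hn)
    (by
      have : f.derivative.eval w = 1 + n * eval w (derivative (X ^ 2 * q)) := by
        simp [f, derivative_mul]
      rw [this]
      intro h
      have h1 := v.asIdeal.sub_mem h (v.asIdeal.mul_mem_right (eval w (derivative (X ^ 2 * q))) hn)
      rw [add_sub_cancel_right] at h1
      exact v.isPrime.ne_top ((Ideal.eq_top_iff_one _).2 h1))
  refine ⟨1 + (n : v.adicCompletion K) ^ 2 * z, ?_⟩
  have := congrArg (aeval z) hf
  simp only [map_pow, map_add, map_mul, map_one, map_natCast, aeval_X, hz, aeval_C] at this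
  rw [this, ← IsScalarTower.algebraMap_apply]
  simp

/-- If the residue field has no primitive `ℓ`-th roots of unity, all its elements are `ℓ`-th
powers, and so are the units of the completion. -/
theorem exists_pow_prime_eq [Finite (R ⧸ v.asIdeal)] {ℓ : ℕ} (hp : ℓ.Prime)
    (hℓ : (ℓ : R) ∉ v.asIdeal) {s : R} (hs : s ∉ v.asIdeal)
    (h : ∀ a : R, (cyclotomic ℓ R).eval a ∉ v.asIdeal) :
    ∃ t : v.adicCompletion K, algebraMap K _ (algebraMap R K s) = t ^ ℓ := by
  have hinj : Function.Injective (powMonoidHom ℓ : (R ⧸ v.asIdeal)ˣ →* (R ⧸ v.asIdeal)ˣ) := by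
    rw [injective_iff_map_eq_one]
    intro u hu
    by_contra hne
    have h1 : IsPrimitiveRoot (u : R ⧸ v.asIdeal) ℓ := by
      rw [IsPrimitiveRoot.coe_units_iff]
      exact IsPrimitiveRoot.iff_orderOf.2 (orderOf_eq_prime (hp := ⟨hp⟩) hu hne)
    obtain ⟨a, ha⟩ := Ideal.Quotient.mk_surjective (u : R ⧸ v.asIdeal)
    refine h a (Ideal.Quotient.eq_zero_iff_mem.1 ?_)
    have := h1.isRoot_cyclotomic hp.pos
    rwa [IsRoot, ← map_cyclotomic ℓ (Ideal.Quotient.mk v.asIdeal), ← ha, eval_map_apply] at this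
  have hs0 : Ideal.Quotient.mk v.asIdeal s ≠ 0 := fun h0 => hs (Ideal.Quotient.eq_zero_iff_mem.1 h0)
  let _ := Ideal.Quotient.field v.asIdeal
  obtain ⟨u, hu⟩ := (Finite.injective_iff_surjective.1 hinj) (Units.mk0 _ hs0)
  obtain ⟨a, ha⟩ := Ideal.Quotient.mk_surjective (u : R ⧸ v.asIdeal)
  refine exists_pow_eq_of_pow_sub_mem K v hℓ (a := a) hs (Ideal.Quotient.eq_zero_iff_mem.1 ?_)
  have := congrArg Units.val hu
  simp only [powMonoidHom_apply, Units.val_pow_eq_pow_val, Units.val_mk0] at this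
  rw [map_sub, map_pow, ha, this, sub_self]

/-- If `-1` is not a square in the residue field, then of two opposite units one is a square. -/
theorem exists_sq_eq_or [Finite (R ⧸ v.asIdeal)] (h2 : ((2 : ℕ) : R) ∉ v.asIdeal) {s : R}
    (hs : s ∉ v.asIdeal) (h : ∀ a : R, (cyclotomic 4 R).eval a ∉ v.asIdeal) :
    ∃ t : v.adicCompletion K, algebraMap K _ (algebraMap R K s) = t ^ 2 ∨
      algebraMap K _ (algebraMap R K (-s)) = t ^ 2 := by
  classical
  let _ := Ideal.Quotient.field v.asIdeal
  let _ := Fintype.ofFinite (R ⧸ v.asIdeal)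
  have hs0 : Ideal.Quotient.mk v.asIdeal s ≠ 0 := fun h0 => hs (Ideal.Quotient.eq_zero_iff_mem.1 h0)
  have hneg : ¬ IsSquare (-1 : R ⧸ v.asIdeal) := by
    rintro ⟨i, hi⟩
    obtain ⟨a, rfl⟩ := Ideal.Quotient.mk_surjective i
    refine h a (Ideal.Quotient.eq_zero_iff_mem.1 ?_)
    rw [show (4 : ℕ) = 2 ^ 2 by norm_num, cyclotomic_prime_pow_eq_geom_sum Nat.prime_two]
    simp [Finset.sum_range_succ]
    linear_combination -hi
  have key : IsSquare (Ideal.Quotient.mk v.asIdeal s) ∨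
      IsSquare (Ideal.Quotient.mk v.asIdeal (-s)) := by
    by_contra! hcon
    have h1 := quadraticChar_neg_one_iff_not_isSquare.2 hcon.1
    have h3 := quadraticChar_neg_one_iff_not_isSquare.2 hneg
    have h4 := quadraticChar_neg_one_iff_not_isSquare.2 hcon.2
    rw [map_neg, neg_eq_neg_one_mul, map_mul, h1, h3] at h4
    norm_num at h4
  have lift (x : R) (hx : x ∉ v.asIdeal) (hsq : IsSquare (Ideal.Quotient.mk v.asIdeal x)) :
      ∃ t : v.adicCompletion K, algebraMap K _ (algebraMap R K x) = t ^ 2 := by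
    obtain ⟨b, hb⟩ := hsq
    obtain ⟨a, rfl⟩ := Ideal.Quotient.mk_surjective b
    refine exists_pow_eq_of_pow_sub_mem K v h2 (a := a) hx (Ideal.Quotient.eq_zero_iff_mem.1 ?_)
    rw [map_sub, map_pow, hb]
    ring
  rcases key with h1 | h1
  · exact (lift s hs h1).imp fun _ => Or.inl
  · exact (lift (-s) (fun h3 => hs (by simpa using h3)) h1).imp fun _ => Or.inr

end Local

/-! ### The element with prescribed local behaviour -/

section Global

open Polynomial WithZero

variable {k : Type*} [Field k] [NumberField k]

/-- The primes at which a nonzero element of `k` is not a unit divide a positive integer. -/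
theorem exists_nat_valuation_eq_one {B : k} (hB : B ≠ 0) : ∃ m : ℕ, m ≠ 0 ∧
    ∀ v : HeightOneSpectrum (𝓞 k), (m : 𝓞 k) ∉ v.asIdeal → v.valuation k B = 1 := by
  obtain ⟨x, y, hy, rfl⟩ := IsFractionRing.div_surjective (A := 𝓞 k) B
  have hy0 : y ≠ 0 := nonZeroDivisors.ne_zero hy
  have hx0 : x ≠ 0 := by
    rintro rfl
    simp at hB
  refine ⟨Ideal.absNorm (Ideal.span {x}) * Ideal.absNorm (Ideal.span {y}), ?_, fun v hv => ?_⟩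
  · refine mul_ne_zero ?_ ?_ <;> rw [Ne, Ideal.absNorm_eq_zero_iff, Ideal.span_singleton_eq_bot]
    · exact hx0
    · exact hy0
  · have key (z : 𝓞 k) (hz : (Ideal.absNorm (Ideal.span {z}) : 𝓞 k) ∉ v.asIdeal) :
        v.valuation k (algebraMap (𝓞 k) k z) = 1 := by
      rw [v.valuation_eq_one_iff_notMem]
      exact fun h => hz ((Ideal.span_singleton_le_iff_mem _).2 h (Ideal.absNorm_mem _))
    push_cast at hv
    rw [map_div₀, key x fun h => hv (Ideal.mul_mem_right _ _ h),
      key y fun h => hv (Ideal.mul_mem_left _ _ h), div_one]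

/-- A cyclotomic value that has valuation `1` at some prime: start with a prime `P` dividing
`Φ_N(m)`. If `Φ_N(m)` lies in `P ^ 2`, then `Φ_N(m + m t)` does not, for `t` of valuation `1`, as
`m` is a simple root of `Φ_N` modulo `P`. -/
theorem exists_cyclotomic_eval_mem_notMem_sq {N m : ℕ} (hN : 2 ≤ N) (hm : 2 ≤ m) (hNm : N ∣ m) :
    ∃ (y : 𝓞 k) (v : HeightOneSpectrum (𝓞 k)), (m : 𝓞 k) ∣ y ∧ (m : 𝓞 k) ∉ v.asIdeal ∧
      (cyclotomic N (𝓞 k)).eval y ∈ v.asIdeal ∧ (cyclotomic N (𝓞 k)).eval y ∉ v.asIdeal ^ 2 := by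
  have hval : (cyclotomic N (𝓞 k)).eval (m : 𝓞 k) =
      algebraMap ℤ (𝓞 k) ((cyclotomic N ℤ).eval (m : ℤ)) := by
    rw [← map_cyclotomic N (algebraMap ℤ (𝓞 k)), ← map_natCast (algebraMap ℤ (𝓞 k)), eval_map_apply]
  have habs := sub_one_lt_natAbs_cyclotomic_eval (n := N) (q := m) (by omega) (by omega)
  have hnu : ¬ IsUnit ((cyclotomic N (𝓞 k)).eval (m : 𝓞 k)) := by
    intro h
    rw [hval] at h
    have := Int.isUnit_iff_natAbs_eq.1 (isUnit_of_map_unit (algebraMap ℤ (𝓞 k)) _ h)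
    omega
  have hne : (cyclotomic N (𝓞 k)).eval (m : 𝓞 k) ≠ 0 := by
    rw [hval, Ne, FaithfulSMul.algebraMap_eq_zero_iff]
    intro h0
    rw [h0] at habs
    simp at habs
  obtain ⟨P, hP, hle⟩ := Ideal.exists_le_maximal _ (mt Ideal.span_singleton_eq_top.1 hnu)
  have hmem : (cyclotomic N (𝓞 k)).eval (m : 𝓞 k) ∈ P := (Ideal.span_singleton_le_iff_mem _).1 hle
  have hP0 : P ≠ ⊥ := by
    rintro rfl
    exact hne (by simpa using hmem)
  let v : HeightOneSpectrum (𝓞 k) := ⟨P, hP.isPrime, hP0⟩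
  have hmP : (m : 𝓞 k) ∉ P := by
    intro h
    obtain ⟨w, hw⟩ := exists_cyclotomic_eval_eq hN (m : 𝓞 k)
    rw [hw] at hmem
    have := P.sub_mem hmem (P.mul_mem_right w h)
    rw [add_sub_cancel_right] at this
    exact hP.ne_top ((Ideal.eq_top_iff_one P).2 this)
  by_cases hsq : (cyclotomic N (𝓞 k)).eval (m : 𝓞 k) ∈ P ^ 2
  · obtain ⟨t, ht, ht2⟩ := Ideal.exists_mem_pow_notMem_pow_succ P hP0 hP.ne_top 1
    rw [pow_one] at ht
    obtain ⟨q, hq⟩ := (cyclotomic N (𝓞 k)).binomExpansion (m : 𝓞 k) (m * t)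
    have hNP : (N : 𝓞 k) ∉ P := by
      intro h
      obtain ⟨c, rfl⟩ := hNm
      rw [Nat.cast_mul] at hmP
      exact hmP (P.mul_mem_right _ h)
    refine ⟨m + m * t, v, ⟨1 + t, by ring⟩, hmP, ?_, ?_⟩
    · rw [hq]
      refine P.add_mem (P.add_mem hmem ?_) ?_
      · exact P.mul_mem_left _ (P.mul_mem_left _ ht)
      · rw [pow_two]
        exact P.mul_mem_left _ (P.mul_mem_left _ (P.mul_mem_left _ ht))
    · intro h
      rw [hq] at h
      have h1 : q * (m * t) ^ 2 ∈ P ^ 2 := by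
        rw [mul_pow]
        exact Ideal.mul_mem_left _ _ (Ideal.mul_mem_left _ _ (Ideal.pow_mem_pow ht 2))
      have h2 := (P ^ 2).sub_mem ((P ^ 2).sub_mem h h1) hsq
      have h3 : ((cyclotomic N (𝓞 k)).derivative.eval (m : 𝓞 k) * m) * t ∈ P ^ 2 := by
        convert h2 using 1
        ring
      rcases Ideal.IsMaximal.mul_mem_pow P h3 with h4 | h4
      · exact (hP.isPrime.mem_or_mem h4).elim (derivative_cyclotomic_eval_notMem hNP hmem) hmP
      · exact ht2 h4
  · exact ⟨m, v, dvd_rfl, hmP, hmem, hsq⟩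

/-- An element of valuation `1` at `v`, raised to the power `q`, is not an `nq`-th power for
`n ≥ 2`, even up to a unit at `v`. -/
theorem pow_mul_ne_pow {R K : Type*} [CommRing R] [IsDedekindDomain R] [Field K] [Algebra R K]
    [IsFractionRing R K] (v : HeightOneSpectrum R) {s : R} (hs : s ∈ v.asIdeal)
    (hs2 : s ∉ v.asIdeal ^ 2) {n q : ℕ} (hn : 2 ≤ n) (hq : q ≠ 0) {u : K}
    (hu : v.valuation K u = 1) (t : K) : (algebraMap R K s) ^ q * u ≠ t ^ (n * q) := by
  intro h
  have hval : v.valuation K (algebraMap R K s) = exp (-1 : ℤ) := by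
    rw [v.valuation_of_algebraMap]
    have h1 := (v.intValuation_le_pow_iff_mem s 1).2 (by simpa using hs)
    have h2 := mt (v.intValuation_le_pow_iff_mem s 2).1 hs2
    have hne : v.intValuation s ≠ 0 := by
      refine v.intValuation_ne_zero s ?_
      rintro rfl
      simp at hs2
    obtain ⟨z, hz⟩ : ∃ z : ℤ, exp z = v.intValuation s := ⟨log _, exp_log hne⟩
    rw [← hz, exp_le_exp] at h1 h2
    rw [← hz]
    congr 1
    push_cast at h1 h2
    omega
  have h1 := congrArg (v.valuation K) h
  rw [map_mul, map_pow, hu, mul_one, hval, map_pow, pow_mul] at h1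
  have h2 : exp (-1 : ℤ) = v.valuation K t ^ n := (pow_left_inj₀ zero_le zero_le hq).1 h1
  have hne : v.valuation K t ≠ 0 := by
    intro h0
    rw [h0, zero_pow (by omega)] at h2
    exact exp_ne_zero h2
  obtain ⟨z, hz⟩ : ∃ z : ℤ, exp z = v.valuation K t := ⟨log _, exp_log hne⟩
  rw [← hz, ← exp_nsmul, exp_inj] at h2
  have h3 : (n : ℤ) ∣ 1 := ⟨-z, by rw [nsmul_eq_mul] at h2; linarith⟩
  have := Int.le_of_dvd one_pos h3
  omega

/-- The common part of the two cases. Here `B` becomes an `nq`-th power once there are primitive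
`N`-th roots of unity, and `hs` says that the `q`-th power of a `v`-adic unit is an `nq`-th power
if the residue field, of characteristic prime to `N`, contains no such roots. For a suitable value
`s` of `Φ_N` the coefficients `1, -s ^ q, -B, s ^ q B` give a counterexample to the Hasse principle
for lines: primes dividing `s` but not `N` have primitive `N`-th roots of unity in their residue
fields, and `s` is congruent to `1` modulo `N ^ 3`. -/
theorem exists_failsHassePrincipleForLines [IsTotallyReal k] {N n q : ℕ} (hN : 2 ≤ N)
    (hn : 2 ≤ n) (hnN : n ∣ N) (hq : Even q) (hq0 : q ≠ 0) {B : k} (hB0 : B ≠ 0)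
    (hB : ¬ ∃ t : k, B = t ^ (n * q))
    (hBv : ∀ (v : HeightOneSpectrum (𝓞 k)) (ζ : v.adicCompletion k), IsPrimitiveRoot ζ N →
      ∃ t : v.adicCompletion k, algebraMap k _ B = t ^ (n * q))
    (hs : ∀ (v : HeightOneSpectrum (𝓞 k)), (N : 𝓞 k) ∉ v.asIdeal → ∀ s : 𝓞 k, s ∉ v.asIdeal →
      (∀ a : 𝓞 k, (cyclotomic N (𝓞 k)).eval a ∉ v.asIdeal) →
      ∃ t : v.adicCompletion k, algebraMap k _ (algebraMap (𝓞 k) k s) ^ q = t ^ (n * q))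
    (hnv : ∀ v : HeightOneSpectrum (𝓞 k), (N : 𝓞 k) ∈ v.asIdeal → (n : 𝓞 k) ∈ v.asIdeal) :
    ∃ a : Fin 4 → kˣ, FailsHassePrincipleForLines (diagonalForm (n * q) a) := by
  obtain ⟨m, hm0, hm⟩ := exists_nat_valuation_eq_one hB0
  obtain ⟨y, P, hy, hMP, hyP, hyP2⟩ := exists_cyclotomic_eval_mem_notMem_sq (k := k) (N := N)
    (m := N ^ 3 * m) hN ((Nat.le_self_pow three_ne_zero N).trans
      (Nat.le_mul_of_pos_right _ (Nat.pos_of_ne_zero hm0)) |> hN.trans)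
    (Dvd.dvd.mul_right (dvd_pow_self N three_ne_zero) m)
  set s := (cyclotomic N (𝓞 k)).eval y with hsdef
  have hs0 : s ≠ 0 := by
    intro h
    rw [h] at hyP2
    simp at hyP2
  have hs0' : algebraMap (𝓞 k) k s ≠ 0 := by simpa using hs0
  have hBP : P.valuation k B = 1 := hm P fun h => hMP (by
    rw [Nat.cast_mul]
    exact Ideal.mul_mem_left _ _ h)
  have hd3 : 3 ≤ n * q := by
    obtain ⟨r, rfl⟩ := hq
    have : 1 ≤ r := by omega
    nlinarith
  let A : kˣ := Units.mk0 (algebraMap (𝓞 k) k s ^ q) (pow_ne_zero _ hs0')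
  refine ⟨pairedCoeffs A (Units.mk0 B hB0), fun v => ?_, fun v => ?_, fun hline => ?_⟩
  · refine containsLineOver_of_isPow _ _ ?_
    let e := InfinitePlace.Completion.ringEquivRealOfIsReal (IsTotallyReal.isReal v)
    have hpos : 0 ≤ e (algebraMap k v.Completion A) := by
      simp only [A, Units.val_mk0, map_pow]
      exact hq.pow_nonneg _
    refine ⟨e.symm (e (algebraMap k v.Completion A) ^ ((n * q : ℕ) : ℝ)⁻¹), Or.inl ?_⟩
    rw [← map_pow, Real.rpow_inv_natCast_pow hpos (by omega), RingEquiv.symm_apply_apply]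
  · refine containsLineOver_of_isPow _ _ ?_
    have hA : algebraMap k (v.adicCompletion k) A =
        algebraMap k (v.adicCompletion k) (algebraMap (𝓞 k) k s) ^ q := by
      simp only [A, Units.val_mk0, map_pow]
    rw [hA]
    by_cases hNv : (N : 𝓞 k) ∈ v.asIdeal
    · obtain ⟨w, hw⟩ := exists_cyclotomic_eval_eq hN y
      obtain ⟨y', rfl⟩ := hy
      obtain ⟨c, rfl⟩ := hnN
      have hs1 : s = 1 + n ^ 3 * (c ^ 3 * m * y' * w) := by
        rw [hsdef, hw]
        push_cast
        ring
      obtain ⟨t, ht⟩ := exists_pow_eq_of_mem k v (hnv v hNv) (c ^ 3 * m * y' * w)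
      exact ⟨t, Or.inl (by rw [hs1, ht, pow_mul])⟩
    · by_cases hroot : ∃ a : 𝓞 k, (cyclotomic N (𝓞 k)).eval a ∈ v.asIdeal
      · obtain ⟨a, ha⟩ := hroot
        obtain ⟨ζ, hζ⟩ := exists_isPrimitiveRoot_adicCompletion k v hNv ha
        exact (hBv v ζ hζ).imp fun _ => Or.inr
      · push Not at hroot
        exact (hs v hNv s (hroot y) hroot).imp fun _ => Or.inl
  · obtain ⟨t, h | h | h⟩ := isPow_of_containsLineOver hd3 _ _ hline
    · refine pow_mul_ne_pow (K := k) P hyP hyP2 hn hq0 (map_one _) t ?_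
      simpa [A] using h
    · exact hB ⟨t, h⟩
    · refine pow_mul_ne_pow (K := k) P hyP hyP2 hn hq0 (u := -B) (by rwa [Valuation.map_neg]) t ?_
      simpa [A] using h

end Global

theorem theorem4 (d : ℕ) (hd : 4 ≤ d) (hd_even : Even d)
    (k : Type*) [Field k] [NumberField k] [IsTotallyReal k] :
    ∃ a : Fin 4 → kˣ, FailsHassePrincipleForLines (diagonalForm d a) := by
  by_cases h4 : 4 ∣ d
  · obtain ⟨B, hB0, hB, hK⟩ := exists_not_isPow_of_four_dvd k (by omega) h4
    obtain ⟨c, rfl⟩ := h4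
    rw [show 4 * c = 2 * (2 * c) by ring] at hB hK ⊢
    refine exists_failsHassePrincipleForLines (N := 4) (by norm_num) le_rfl (by norm_num)
      (even_two_mul c) (by omega) hB0 hB (fun v ζ hζ => hK _ ζ ?_) (fun v hv s hs hroot => ?_)
      fun v hv => ?_
    · have h1 : (ζ ^ 2) ^ 2 = 1 := by rw [← pow_mul, hζ.pow_eq_one]
      refine (sq_eq_one_iff.1 h1).resolve_left ?_
      exact hζ.pow_ne_one_of_pos_of_lt two_ne_zero (by norm_num)
    · have h2 : ((2 : ℕ) : 𝓞 k) ∉ v.asIdeal := fun h => hv (by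
        rw [show ((4 : ℕ) : 𝓞 k) = 2 * ((2 : ℕ) : 𝓞 k) by norm_num]
        exact Ideal.mul_mem_left _ _ h)
      obtain ⟨t, ht | ht⟩ := exists_sq_eq_or k v h2 hs hroot
      · exact ⟨t, by rw [ht, ← pow_mul]⟩
      · refine ⟨t, ?_⟩
        rw [pow_mul t, ← ht, map_neg, map_neg, (even_two_mul c).neg_pow]
    · refine v.isPrime.mem_of_pow_mem 2 ?_
      convert hv using 1
      norm_num
  · obtain ⟨e, rfl⟩ := hd_even.two_dvd
    have he : Odd e := by
      rw [← Nat.not_even_iff_odd]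
      rintro ⟨c, rfl⟩
      exact h4 ⟨c, by ring⟩
    obtain ⟨ℓ, hp, c, rfl⟩ := Nat.exists_prime_and_dvd (show e ≠ 1 by omega)
    have hℓ : ℓ ≠ 2 := by
      rintro rfl
      exact Nat.not_odd_iff_even.2 (even_two_mul c) he
    obtain ⟨B, hB0, hB, hK⟩ := exists_not_isPow_of_isPrimitiveRoot k he hp hℓ
    rw [show 2 * (ℓ * c) = ℓ * (2 * c) by ring] at hB hK ⊢
    refine exists_failsHassePrincipleForLines (N := ℓ) hp.two_le hp.two_le dvd_rfl
      (even_two_mul c) (by rintro h; simp_all) hB0 hB (fun v ζ hζ => hK _ ζ hζ)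
      (fun v hv s hs hroot => ?_) fun v hv => hv
    obtain ⟨t, ht⟩ := exists_pow_prime_eq k v hp hv hs hroot
    exact ⟨t, by rw [ht, ← pow_mul]⟩
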